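/- All systems are finite-dimensional. An \emph{entanglement measure} is a real-valued function $E$ of bipartite states in all finite dimensions, written $E_{X:Y}$ for the bipartition $X:Y$, that is not increased by deterministic finite-round protocols of local operations and classical communication (LOCC; local operations may change the local dimensions, so tracing out a local subsystem or adding an uncorrelated local ancilla are included). A channel $\Phi$ from $C$ to $D$ (for instance $D$ a copy of $C$) is \emph{entanglement breaking} if for every reference system $R$ and every state $\rho_{RC}$ the state $(\mathcal I_R\otimes\Phi)(\rho_{RC})$ is separable. Let $\Phi$ be an entanglement-breaking channel from $C$ to $D$. Then: (1) There are a finite POVM $(M_n)$ on $C$ and pure states $\gamma_n=|\gamma_n\rangle\langle\gamma_n|$ of $D$ such that $\Phi(X)=\sum_n \mathrm{Tr}(M_nX)\,\gamma_n$ for all operators $X$ on $C$. (2) Take any such representation of $\Phi$, any operators $K_n$ on $C$ with $K_n^\dagger K_n=M_n$, and any systems $A,B$. Consider the procedure $\Lambda$ on $ABCD$ in which Alice, who holds $AC$, measures $C$ with the Kraus operators $K_n$ and sends the outcome $n$ to Bob, who holds $BD$ and resets $D$ to $\gamma_n$, after which the outcome is forgotten. Then $\Lambda$ is LOCC with respect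 to $AC:BD$. For every state $\rho_{ABC}$, $$(\mathcal I_{AB}\otimes\Phi)(\rho_{ABC})=\sum_n p_n\,\rho_{AB|n}\otimes\gamma_n,\qquad p_n\,\rho_{AB|n}=\mathrm{Tr}_C[(\mathbb 1_{AB}\otimes M_n)\rho_{ABC}],$$ and for every state $\delta_D$ of Bob's ancilla, $\mathrm{Tr}_C\,\Lambda(\rho_{ABC}\otimes\delta_D)=(\mathcal I_{AB}\otimes\Phi)(\rho_{ABC})$. For every entanglement measure $E$, $$E'_{A:BD}-E_{AC:B}\;\le\;E'_{AC:BD}-E_{AC:BD}\;\le\;0,$$ where $E_{AC:B}$ is evaluated at $\rho_{ABC}$, $E_{AC:BD}$ at $\rho_{ABC}\otimes\delta_D$, $E'_{AC:BD}$ at $\Lambda(\rho_{ABC}\otimes\delta_D)$, and $E'_{A:BD}$ at $(\mathcal I_{AB}\otimes\Phi)(\rho_{ABC})$. (3) Consequently, for all systems $A,B$, all states $\rho_{ABC}$ and every entanglement measure $E$, sending the carrier $C$ from Alice to Bob through $\Phi$ gives no entanglement gain between the laboratories: $E'_{A:BD}\le E_{AC:B}$. -/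

import Mathlib

open scoped Kronecker Matrix ComplexOrder

namespace EntDist

/-- Density matrices of a finite-dimensional system with computational basis `X`. -/
def IsDensityMatrix {X : Type} [Fintype X] (ρ : Matrix X X ℂ) : Prop :=
  ρ.PosSemidef ∧ ρ.trace = 1

/-- The projector `|v⟩⟨v|`. -/
def pureState {X : Type} (v : X → ℂ) : Matrix X X ℂ :=
  Matrix.vecMulVec v (star v)

/-- A bipartite density matrix is separable if it is a finite convex combination of
product states. -/
def IsSeparable {X Y : Type} [Fintype X] [Fintype Y]
    (ρ : Matrix (X × Y) (X × Y) ℂ) : Prop :=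
  ∃ (k : ℕ) (p : Fin k → ℝ) (σ : Fin k → Matrix X X ℂ) (τ : Fin k → Matrix Y Y ℂ),
    (∀ i, 0 ≤ p i) ∧ ∑ i, p i = 1 ∧
    (∀ i, IsDensityMatrix (σ i)) ∧ (∀ i, IsDensityMatrix (τ i)) ∧
    ρ = ∑ i, (p i : ℂ) • (σ i ⊗ₖ τ i)

/-- The map `id_R ⊗ Φ`: `Φ` is applied to each block of an operator on `R ⊗ C`. -/
def idTensor {C D : Type} (R : Type) (Φ : Matrix C C ℂ →ₗ[ℂ] Matrix D D ℂ)
    (ρ : Matrix (R × C) (R × C) ℂ) : Matrix (R × D) (R × D) ℂ :=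
  Matrix.of fun x y => Φ (Matrix.of fun c c' => ρ (x.1, c) (y.1, c')) x.2 y.2

/-- Quantum channels: completely positive trace-preserving linear maps. -/
def IsChannel {C D : Type} [Fintype C] [Fintype D]
    (Φ : Matrix C C ℂ →ₗ[ℂ] Matrix D D ℂ) : Prop :=
  (∀ (R : Type) [Fintype R] (ρ : Matrix (R × C) (R × C) ℂ),
    ρ.PosSemidef → (idTensor R Φ ρ).PosSemidef) ∧
  ∀ X : Matrix C C ℂ, (Φ X).trace = X.trace

/-- A channel is entanglement breaking if, whatever the reference system `R` and the input
state of `R ⊗ C`, the output is separable between `R` and the system leaving the channel. -/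
def IsEntanglementBreaking {C D : Type} [Fintype C] [Fintype D]
    (Φ : Matrix C C ℂ →ₗ[ℂ] Matrix D D ℂ) : Prop :=
  IsChannel Φ ∧
  ∀ (R : Type) [Fintype R] (ρ : Matrix (R × C) (R × C) ℂ),
    IsDensityMatrix ρ → IsSeparable (idTensor R Φ ρ)

/-- The map `X ↦ K X Kᴴ`. -/
def conjBy {X X' : Type} [Fintype X] (K : Matrix X' X ℂ) (ρ : Matrix X X ℂ) :
    Matrix X' X' ℂ :=
  K * ρ * Kᴴ

/-- `IsLOCC Λ`: the map `Λ`, from operators on `X ⊗ Y` to operators on `X' ⊗ Y'`, is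
implemented by local operations and classical communication in finitely many rounds, the
first tensor factor being held by Alice and the second one by Bob. A protocol is a finite tree.
Either nothing is done, or one of the parties performs a local quantum measurement with Kraus
operators `K n` (possibly changing the dimension of the local system), announces the outcome
`n`, and the parties go on with an LOCC protocol that may depend on `n`. At the end the
record of outcomes is discarded, that is, the branches are summed. (Coarse-grained local
instruments, and in particular all local channels, are the case of a protocol that ignores part
of the outcome.) -/
inductive IsLOCC {X' Y' : Type} [Fintype X'] [DecidableEq X'] [Fintype Y'] [DecidableEq Y'] :
    ∀ {X Y : Type} [Fintype X] [DecidableEq X] [Fintype Y] [DecidableEq Y],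
      (Matrix (X × Y) (X × Y) ℂ → Matrix (X' × Y') (X' × Y') ℂ) → Prop
  | done : IsLOCC (X := X') (Y := Y') (fun ρ => ρ)
  | alice {X Y Z ι : Type} [Fintype X] [DecidableEq X] [Fintype Y] [DecidableEq Y]
      [Fintype Z] [DecidableEq Z] [Fintype ι]
      (K : ι → Matrix Z X ℂ) (hK : ∑ n, (K n)ᴴ * K n = 1)
      (Λ : ι → Matrix (Z × Y) (Z × Y) ℂ → Matrix (X' × Y') (X' × Y') ℂ)
      (hΛ : ∀ n, IsLOCC (Λ n)) :
      IsLOCC (X := X) (Y := Y)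
        (fun ρ => ∑ n, Λ n (conjBy (K n ⊗ₖ (1 : Matrix Y Y ℂ)) ρ))
  | bob {X Y Z ι : Type} [Fintype X] [DecidableEq X] [Fintype Y] [DecidableEq Y]
      [Fintype Z] [DecidableEq Z] [Fintype ι]
      (K : ι → Matrix Z Y ℂ) (hK : ∑ n, (K n)ᴴ * K n = 1)
      (Λ : ι → Matrix (X × Z) (X × Z) ℂ → Matrix (X' × Y') (X' × Y') ℂ)
      (hΛ : ∀ n, IsLOCC (Λ n)) :
      IsLOCC (X := X) (Y := Y)
        (fun ρ => ∑ n, Λ n (conjBy ((1 : Matrix X X ℂ) ⊗ₖ K n) ρ))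

/-- An entanglement measure `E`, where `E X Y ρ` stands for `E_{X:Y}(ρ)`, is a real function of
bipartite states in all finite dimensions that no LOCC protocol increases. Only the values
at density matrices matter. -/
def IsEntanglementMonotone (E : ∀ X Y : Type, Matrix (X × Y) (X × Y) ℂ → ℝ) : Prop :=
  ∀ (X Y X' Y' : Type) [Fintype X] [DecidableEq X] [Fintype Y] [DecidableEq Y]
    [Fintype X'] [DecidableEq X'] [Fintype Y'] [DecidableEq Y']
    (Λ : Matrix (X × Y) (X × Y) ℂ → Matrix (X' × Y') (X' × Y') ℂ), IsLOCC Λ →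
    ∀ ρ : Matrix (X × Y) (X × Y) ℂ, IsDensityMatrix ρ → E X' Y' (Λ ρ) ≤ E X Y ρ

/-- Positive operator-valued measures with outcomes `Fin k`. -/
def IsPOVM {C : Type} [Fintype C] [DecidableEq C] {k : ℕ} (M : Fin k → Matrix C C ℂ) : Prop :=
  (∀ n, (M n).PosSemidef) ∧ ∑ n, M n = 1

/-- `Φ` measures the POVM `M` and prepares the pure state `|γ n⟩⟨γ n|` upon the outcome `n`. -/
def IsMeasurePrepare {C D : Type} [Fintype C] [DecidableEq C] [Fintype D] {k : ℕ}
    (Φ : Matrix C C ℂ →ₗ[ℂ] Matrix D D ℂ)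
    (M : Fin k → Matrix C C ℂ) (γ : Fin k → D → ℂ) : Prop :=
  IsPOVM M ∧ (∀ n, star (γ n) ⬝ᵥ γ n = 1) ∧
  ∀ X : Matrix C C ℂ, Φ X = ∑ n, (M n * X).trace • pureState (γ n)

/-- `tr_C [(1 ⊗ M) ρ]`. For a POVM element `M n` this is `p n • ρ_{R|n}`, the state of `R`
conditioned on the outcome `n` multiplied by the probability `p n` of that outcome. -/
def condOp {R C : Type} [Fintype R] [DecidableEq R] [Fintype C]
    (M : Matrix C C ℂ) (ρ : Matrix (R × C) (R × C) ℂ) : Matrix R R ℂ :=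
  Matrix.of fun r r' => ∑ c, (((1 : Matrix R R ℂ) ⊗ₖ M) * ρ) (r, c) (r', c)

/-- An operator on `A, B, C`, viewed in the bipartition `AC : B`. -/
def cutACB {A B C : Type} (ρ : Matrix ((A × B) × C) ((A × B) × C) ℂ) :
    Matrix ((A × C) × B) ((A × C) × B) ℂ :=
  ρ.submatrix (fun x => ((x.1.1, x.2), x.1.2)) (fun x => ((x.1.1, x.2), x.1.2))

/-- An operator on `A, B, D`, viewed in the bipartition `A : BD`. -/
def cutABD {A B D : Type} (ρ : Matrix ((A × B) × D) ((A × B) × D) ℂ) :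
    Matrix (A × (B × D)) (A × (B × D)) ℂ :=
  ρ.submatrix (fun x => ((x.1, x.2.1), x.2.2)) (fun x => ((x.1, x.2.1), x.2.2))

/-- The state `ρ_{ABC} ⊗ δ_D`, viewed in the bipartition `AC : BD`. -/
def withAncilla {A B C D : Type} (ρ : Matrix ((A × B) × C) ((A × B) × C) ℂ)
    (δ : Matrix D D ℂ) : Matrix ((A × C) × (B × D)) ((A × C) × (B × D)) ℂ :=
  (ρ ⊗ₖ δ).submatrix (fun x => (((x.1.1, x.2.1), x.1.2), x.2.2))
    (fun x => (((x.1.1, x.2.1), x.1.2), x.2.2))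

/-- The partial trace over `C` of an operator in the bipartition `AC : BD`. -/
def traceC {A B C D : Type} [Fintype C]
    (ω : Matrix ((A × C) × (B × D)) ((A × C) × (B × D)) ℂ) :
    Matrix (A × (B × D)) (A × (B × D)) ℂ :=
  Matrix.of fun x y => ∑ c, ω ((x.1, c), x.2) ((y.1, c), y.2)

/-- The measure-and-prepare procedure that replaces the transmission of `C`. Alice measures
`C` with Kraus operators `K n` (so the POVM is `(K n)ᴴ * K n`, and `C` stays in her laboratory in
its post-measurement state) and sends the outcome `n` to Bob, who resets his ancilla `D` to
`|γ n⟩⟨γ n|` (Kraus operators `|γ n⟩⟨d|`); then the outcome is forgotten. -/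
noncomputable def measurePrepareProcedure {A B C D : Type} [Fintype A] [DecidableEq A]
    [Fintype B] [DecidableEq B] [Fintype C] [Fintype D] [DecidableEq D] {k : ℕ}
    (K : Fin k → Matrix C C ℂ) (γ : Fin k → D → ℂ)
    (ω : Matrix ((A × C) × (B × D)) ((A × C) × (B × D)) ℂ) :
    Matrix ((A × C) × (B × D)) ((A × C) × (B × D)) ℂ :=
  ∑ n, ∑ d : D,
    conjBy (((1 : Matrix A A ℂ) ⊗ₖ K n) ⊗ₖ
      ((1 : Matrix B B ℂ) ⊗ₖ Matrix.vecMulVec (γ n) (Pi.single d 1))) ω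

end EntDist

namespace EntDist

open Matrix

/-! ### Local operations and classical communication -/

/-! Applied to half of a maximally entangled state, `Φ` gives its Choi matrix, which is separable by
hypothesis. A separable decomposition, with Bob's factors split spectrally, is a measure-and-prepare
form of `Φ` (`IsEntanglementBreaking.exists_isMeasurePrepare`). Such a form needs only a classical
message: Alice measures `C`, Bob prepares `γ n` in a local ancilla. Starting from `ρ`, Bob adds `δ`
(`exists_isLOCC_withAncilla`), the procedure runs (`measurePrepareProcedure_isLOCC`), and Alice
discards `C` (`traceC_isLOCC`). All three steps are LOCC, and the final state is the channel output
(`traceC_measurePrepareProcedure_eq`). Monotonicity at the outer two steps gives the first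
inequality, at the middle one the second; together they exclude any gain. -/

theorem conjBy_mul {X X' X'' : Type} [Fintype X] [Fintype X'] (K : Matrix X'' X' ℂ)
    (L : Matrix X' X ℂ) (ρ : Matrix X X ℂ) : conjBy (K * L) ρ = conjBy K (conjBy L ρ) := by
  simp [conjBy, Matrix.mul_assoc]

theorem conjBy_posSemidef {X X' : Type} [Fintype X] [Fintype X'] (K : Matrix X' X ℂ)
    {ρ : Matrix X X ℂ} (hρ : ρ.PosSemidef) : (conjBy K ρ).PosSemidef :=
  hρ.mul_mul_conjTranspose_same K

theorem sum_trace_conjBy {X X' ι : Type} [Fintype X] [DecidableEq X] [Fintype X'] [Fintype ι]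
    (K : ι → Matrix X' X ℂ) (hK : ∑ n, (K n)ᴴ * K n = 1) (ρ : Matrix X X ℂ) :
    ∑ n, (conjBy (K n) ρ).trace = ρ.trace := by
  have h : ∀ n, (conjBy (K n) ρ).trace = ((K n)ᴴ * K n * ρ).trace := fun n => by
    rw [conjBy, Matrix.trace_mul_comm, Matrix.mul_assoc]
  simp_rw [h, ← Matrix.trace_sum, ← Finset.sum_mul, hK, one_mul]

theorem sum_kronecker_one_isometry {X Y Z ι : Type} [Fintype X] [DecidableEq X] [Fintype Y]
    [DecidableEq Y] [Fintype Z] [Fintype ι] (K : ι → Matrix Z X ℂ)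
    (hK : ∑ n, (K n)ᴴ * K n = 1) :
    ∑ n, (K n ⊗ₖ (1 : Matrix Y Y ℂ))ᴴ * (K n ⊗ₖ (1 : Matrix Y Y ℂ)) = 1 := by
  simp_rw [Matrix.conjTranspose_kronecker, ← Matrix.mul_kronecker_mul]
  rw [← one_kronecker_one, ← hK]
  ext ⟨a, b⟩ ⟨c, d⟩
  simp [Matrix.sum_apply, Finset.sum_mul]

theorem sum_one_kronecker_isometry {X Y Z ι : Type} [Fintype X] [DecidableEq X] [Fintype Y]
    [DecidableEq Y] [Fintype Z] [Fintype ι] (K : ι → Matrix Z Y ℂ)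
    (hK : ∑ n, (K n)ᴴ * K n = 1) :
    ∑ n, ((1 : Matrix X X ℂ) ⊗ₖ K n)ᴴ * ((1 : Matrix X X ℂ) ⊗ₖ K n) = 1 := by
  simp_rw [Matrix.conjTranspose_kronecker, ← Matrix.mul_kronecker_mul]
  rw [← one_kronecker_one, ← hK]
  ext ⟨a, b⟩ ⟨c, d⟩
  simp [Matrix.sum_apply, Finset.mul_sum]

/-- Induction on the protocol tree. Branches carry unnormalised states, so the induction runs over
positive operators and tracks the trace instead of assuming it is one. -/
theorem IsLOCC.posSemidef_and_trace {X' Y' : Type} [Fintype X'] [DecidableEq X'] [Fintype Y']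
    [DecidableEq Y'] {X Y : Type} [Fintype X] [DecidableEq X] [Fintype Y] [DecidableEq Y]
    {Λ : Matrix (X × Y) (X × Y) ℂ → Matrix (X' × Y') (X' × Y') ℂ} (hΛ : IsLOCC Λ) :
    ∀ ρ : Matrix (X × Y) (X × Y) ℂ, ρ.PosSemidef →
      (Λ ρ).PosSemidef ∧ (Λ ρ).trace = ρ.trace := by
  induction hΛ with
  | done => exact fun ρ hρ => ⟨hρ, rfl⟩
  | alice K hK Λ _ ih =>
    intro ρ hρ
    refine ⟨Matrix.posSemidef_sum _ fun n _ => (ih n _ (conjBy_posSemidef _ hρ)).1, ?_⟩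
    rw [Matrix.trace_sum, Finset.sum_congr rfl fun n _ => (ih n _ (conjBy_posSemidef _ hρ)).2]
    exact sum_trace_conjBy _ (sum_kronecker_one_isometry K hK) ρ
  | bob K hK Λ _ ih =>
    intro ρ hρ
    refine ⟨Matrix.posSemidef_sum _ fun n _ => (ih n _ (conjBy_posSemidef _ hρ)).1, ?_⟩
    rw [Matrix.trace_sum, Finset.sum_congr rfl fun n _ => (ih n _ (conjBy_posSemidef _ hρ)).2]
    exact sum_trace_conjBy _ (sum_one_kronecker_isometry K hK) ρ

theorem IsLOCC.isDensityMatrix {X Y X' Y' : Type} [Fintype X] [DecidableEq X] [Fintype Y]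
    [DecidableEq Y] [Fintype X'] [DecidableEq X'] [Fintype Y'] [DecidableEq Y']
    {Λ : Matrix (X × Y) (X × Y) ℂ → Matrix (X' × Y') (X' × Y') ℂ} (hΛ : IsLOCC Λ)
    {ρ : Matrix (X × Y) (X × Y) ℂ} (hρ : IsDensityMatrix ρ) : IsDensityMatrix (Λ ρ) :=
  ⟨(hΛ.posSemidef_and_trace ρ hρ.1).1, (hΛ.posSemidef_and_trace ρ hρ.1).2.trans hρ.2⟩

/-! ### Tracing out a local subsystem -/

theorem conjBy_one_submatrix {X X' : Type} [Fintype X] [DecidableEq X] (f : X' → X)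
    (ω : Matrix X X ℂ) : conjBy ((1 : Matrix X X ℂ).submatrix f id) ω = ω.submatrix f f := by
  ext i j
  simp [conjBy, Matrix.mul_apply, Matrix.one_apply]

/-- Alice measures `C` in the computational basis with Kraus operators `1 ⊗ ⟨c|`, which remove `C`.
These are row selections of the identity matrix, and summing over the outcomes is the partial trace.
-/
theorem traceC_isLOCC {A B C D : Type} [Fintype A] [DecidableEq A] [Fintype B] [DecidableEq B]
    [Fintype C] [DecidableEq C] [Fintype D] [DecidableEq D] :
    IsLOCC (traceC : Matrix ((A × C) × (B × D)) ((A × C) × (B × D)) ℂ → _) := by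
  have hK : ∑ c : C, ((1 : Matrix (A × C) (A × C) ℂ).submatrix (fun a : A => (a, c)) id)ᴴ *
      (1 : Matrix (A × C) (A × C) ℂ).submatrix (fun a : A => (a, c)) id = 1 := by
    ext ⟨a, c⟩ ⟨a', c'⟩
    simp only [Matrix.sum_apply, Matrix.mul_apply, Matrix.conjTranspose_apply,
      Matrix.submatrix_apply]
    rw [Finset.sum_comm, ← Fintype.sum_prod_type' (f := fun (x : A) (y : C) =>
      star ((1 : Matrix (A × C) (A × C) ℂ) (x, y) (id (a, c))) *
        (1 : Matrix (A × C) (A × C) ℂ) (x, y) (id (a', c')))]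
    simp [Matrix.one_apply, eq_comm]
  have h := IsLOCC.alice (Y := B × D) _ hK (fun _ ρ => ρ) (fun _ => IsLOCC.done)
  convert h using 2 with ω
  ext x y
  have hk : ∀ c : C, ((1 : Matrix (A × C) (A × C) ℂ).submatrix (fun a : A => (a, c)) id) ⊗ₖ
      (1 : Matrix (B × D) (B × D) ℂ) =
      (1 : Matrix ((A × C) × (B × D)) ((A × C) × (B × D)) ℂ).submatrix
        (fun x : A × (B × D) => ((x.1, c), x.2)) id := fun c => by
    rw [← one_kronecker_one (m := A × C) (n := B × D)]
    rfl
  simp_rw [hk, conjBy_one_submatrix, Matrix.sum_apply]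
  rfl

/-! ### Adding a local ancilla -/

open scoped MatrixOrder Matrix.Norms.L2Operator in
theorem exists_conjTranspose_mul_self_eq {X : Type} [Fintype X] [DecidableEq X]
    {M : Matrix X X ℂ} (hM : M.PosSemidef) : ∃ K : Matrix X X ℂ, Kᴴ * K = M := by
  obtain ⟨K, rfl⟩ := CStarAlgebra.nonneg_iff_eq_star_mul_self.mp hM.nonneg
  exact ⟨K, rfl⟩

theorem exists_isLOCC_withAncilla {A B C D : Type} [Fintype A] [DecidableEq A] [Fintype B]
    [DecidableEq B] [Fintype C] [DecidableEq C] [Fintype D] [DecidableEq D]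
    {δ : Matrix D D ℂ} (hδ : IsDensityMatrix δ) :
    ∃ Λ : Matrix ((A × C) × B) ((A × C) × B) ℂ →
        Matrix ((A × C) × (B × D)) ((A × C) × (B × D)) ℂ,
      IsLOCC Λ ∧ ∀ ρ : Matrix ((A × B) × C) ((A × B) × C) ℂ,
        Λ (cutACB ρ) = withAncilla ρ δ := by
  obtain ⟨S, rfl⟩ : ∃ S : Matrix D D ℂ, δ = S * Sᴴ := by
    obtain ⟨T, hT⟩ := exists_conjTranspose_mul_self_eq hδ.1
    exact ⟨Tᴴ, by simp [hT]⟩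
  have htr : ∑ d, ∑ j, star (S d j) * S d j = 1 := by
    rw [← hδ.2]
    simp [Matrix.trace, Matrix.mul_apply, mul_comm]
  -- With `δ = S Sᴴ`, the operator `K j` is `1 ⊗ S|j⟩`: it appends the `j`-th column of `S`.
  -- Completeness is then the condition `tr δ = 1`.
  let K : D → Matrix (B × D) B ℂ := fun j =>
    Matrix.of fun x b => (1 : Matrix B B ℂ) x.1 b * S x.2 j
  have hK : ∑ j, (K j)ᴴ * K j = 1 := by
    ext b b'
    have h : ∀ j, ((K j)ᴴ * K j) b b' =
        (1 : Matrix B B ℂ) b b' * ∑ d, star (S d j) * S d j := fun j => by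
      by_cases hb : b = b'
      · simp [K, Matrix.mul_apply, Matrix.one_apply, Fintype.sum_prod_type, hb]
      · simp [K, Matrix.mul_apply, Matrix.one_apply, Fintype.sum_prod_type, hb, Ne.symm hb]
    rw [Matrix.sum_apply, Finset.sum_congr rfl fun j _ => h j, ← Finset.mul_sum,
      Finset.sum_comm, htr, mul_one]
  refine ⟨_, IsLOCC.bob (X := A × C) K hK (fun _ ρ => ρ) (fun _ => IsLOCC.done), fun ρ => ?_⟩
  ext ⟨⟨a, c⟩, b, d⟩ ⟨⟨a', c'⟩, b', d'⟩
  have h : ∀ j, conjBy ((1 : Matrix (A × C) (A × C) ℂ) ⊗ₖ K j) (cutACB ρ)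
      ((a, c), b, d) ((a', c'), b', d') = ρ ((a, b), c) ((a', b'), c') * (S d j * star (S d' j)) :=
    fun j => by
      rw [conjBy, Matrix.mul_apply, Finset.sum_eq_single ((a', c'), b'), Matrix.mul_apply,
        Finset.sum_eq_single ((a, c), b)]
      · simp [K, cutACB]
        ring
      · rintro ⟨x, y⟩ - hne
        by_cases hx : (a, c) = x
        · have hy : b ≠ y := fun hy => hne (by rw [hx, hy])
          simp [K, Matrix.one_apply, hy]
        · simp [hx]
      · simp
      · rintro ⟨x, y⟩ - hne
        by_cases hx : (a', c') = x
        · have hy : b' ≠ y := fun hy => hne (by rw [hx, hy])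
          simp [K, Matrix.one_apply, hy]
        · simp [hx]
      · simp
  rw [Matrix.sum_apply, Finset.sum_congr rfl fun j _ => h j, ← Finset.mul_sum]
  simp [withAncilla, Matrix.mul_apply]

theorem cutACB_isDensityMatrix {A B C : Type} [Fintype A] [Fintype B] [Fintype C]
    {ρ : Matrix ((A × B) × C) ((A × B) × C) ℂ} (hρ : IsDensityMatrix ρ) :
    IsDensityMatrix (cutACB ρ) := by
  let e : (A × C) × B ≃ (A × B) × C :=
    ⟨fun x => ((x.1.1, x.2), x.1.2), fun y => ((y.1.1, y.2), y.1.2), fun _ => rfl, fun _ => rfl⟩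
  exact ⟨hρ.1.submatrix e, (Equiv.sum_comp e fun x => ρ x x).trans hρ.2⟩

/-! ### The measure-and-prepare procedure -/

theorem sum_reset_isometry {D : Type} [Fintype D] [DecidableEq D] {v : D → ℂ}
    (hv : star v ⬝ᵥ v = 1) :
    ∑ d : D, (vecMulVec v (Pi.single d 1))ᴴ * vecMulVec v (Pi.single d (1 : ℂ)) = 1 := by
  ext i j
  have h : ∀ d : D, ((vecMulVec v (Pi.single d 1))ᴴ * vecMulVec v (Pi.single d (1 : ℂ))) i j =
      star (Pi.single (M := fun _ : D => ℂ) d 1 i) * Pi.single (M := fun _ : D => ℂ) d 1 j := by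
    intro d
    -- The factor 1 becomes `⟨v|v⟩`, which the product of `|d⟩⟨v|` and `|v⟩⟨d|` produces.
    rw [← mul_one (star _ * _), ← hv]
    simp only [Matrix.mul_apply, conjTranspose_apply, vecMulVec_apply, dotProduct,
      Finset.mul_sum, star_mul, Pi.star_apply]
    exact Finset.sum_congr rfl fun x _ => by ring
  rw [Matrix.sum_apply, Finset.sum_congr rfl fun d _ => h d]
  simp [Pi.single_apply, Matrix.one_apply]

theorem measurePrepareProcedure_isLOCC {A B C D : Type} [Fintype A] [DecidableEq A] [Fintype B]
    [DecidableEq B] [Fintype C] [DecidableEq C] [Fintype D] [DecidableEq D] {k : ℕ}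
    {K : Fin k → Matrix C C ℂ} (hK : ∑ n, (K n)ᴴ * K n = 1) {γ : Fin k → D → ℂ}
    (hγ : ∀ n, star (γ n) ⬝ᵥ γ n = 1) :
    IsLOCC (measurePrepareProcedure (A := A) (B := B) K γ) := by
  have h := IsLOCC.alice (Y := B × D) (fun n => (1 : Matrix A A ℂ) ⊗ₖ K n)
    (sum_one_kronecker_isometry K hK) _ fun n =>
      IsLOCC.bob (X := A × C)
        (fun d : D => (1 : Matrix B B ℂ) ⊗ₖ vecMulVec (γ n) (Pi.single d (1 : ℂ)))
        (sum_one_kronecker_isometry _ (sum_reset_isometry (hγ n)))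
        (fun _ ρ => ρ) (fun _ => IsLOCC.done)
  convert h using 2 with ω
  refine Finset.sum_congr rfl fun n _ => Finset.sum_congr rfl fun d _ => ?_
  rw [← conjBy_mul, ← Matrix.mul_kronecker_mul, one_mul, mul_one]

theorem conjBy_withAncilla {A B C D : Type} [Fintype A] [DecidableEq A] [Fintype B]
    [DecidableEq B] [Fintype C] [Fintype D] (K : Matrix C C ℂ) (V : Matrix D D ℂ)
    (ρ : Matrix ((A × B) × C) ((A × B) × C) ℂ) (δ : Matrix D D ℂ) :
    conjBy (((1 : Matrix A A ℂ) ⊗ₖ K) ⊗ₖ ((1 : Matrix B B ℂ) ⊗ₖ V)) (withAncilla ρ δ) =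
      withAncilla (conjBy ((1 : Matrix (A × B) (A × B) ℂ) ⊗ₖ K) ρ) (conjBy V δ) := by
  let e : (A × C) × (B × D) ≃ ((A × B) × C) × D :=
    ⟨fun x => (((x.1.1, x.2.1), x.1.2), x.2.2), fun y => ((y.1.1.1, y.1.2), y.1.1.2, y.2),
      fun _ => rfl, fun _ => rfl⟩
  have h : ((1 : Matrix A A ℂ) ⊗ₖ K) ⊗ₖ ((1 : Matrix B B ℂ) ⊗ₖ V) =
      (((1 : Matrix (A × B) (A × B) ℂ) ⊗ₖ K) ⊗ₖ V).submatrix e e := by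
    rw [← one_kronecker_one (m := A) (n := B)]
    ext x y
    simp only [kroneckerMap_apply, submatrix_apply, e, Equiv.coe_fn_mk]
    ring
  have hw : ∀ σ τ, withAncilla σ τ = (σ ⊗ₖ τ).submatrix e e := fun _ _ => rfl
  rw [h, hw, hw, conjBy, conjTranspose_submatrix, submatrix_mul_equiv, submatrix_mul_equiv,
    conjTranspose_kronecker, ← mul_kronecker_mul, ← mul_kronecker_mul]
  rfl

theorem conjBy_reset {D : Type} [Fintype D] [DecidableEq D] (v : D → ℂ) (d : D)
    (δ : Matrix D D ℂ) :
    conjBy (vecMulVec v (Pi.single d (1 : ℂ))) δ = δ d d • pureState v := by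
  ext i j
  simp [conjBy, pureState, Matrix.mul_apply, vecMulVec_apply, Pi.single_apply]
  ring

theorem one_kronecker_mul_apply {R C : Type} [Fintype R] [DecidableEq R] [Fintype C]
    (M : Matrix C C ℂ) (ρ : Matrix (R × C) (R × C) ℂ) (r : R) (c : C) (y : R × C) :
    (((1 : Matrix R R ℂ) ⊗ₖ M) * ρ) (r, c) y = ∑ c', M c c' * ρ (r, c') y := by
  rw [Matrix.mul_apply, Fintype.sum_prod_type, Finset.sum_eq_single r]
  · simp
  · intro r' _ hr
    simp [hr.symm]
  · simp

theorem condOp_apply {R C : Type} [Fintype R] [DecidableEq R] [Fintype C]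
    (M : Matrix C C ℂ) (ρ : Matrix (R × C) (R × C) ℂ) (r r' : R) :
    condOp M ρ r r' = (M * Matrix.of fun c c' => ρ (r, c) (r', c')).trace := by
  simp only [condOp, of_apply, one_kronecker_mul_apply]
  simp [Matrix.trace, Matrix.mul_apply]

/-- Cyclicity of the trace on `C`, used in each block of `ρ` separately: once `C` is traced out,
only the POVM element matters and not its Kraus operator. -/
theorem sum_conjBy_apply {R C : Type} [Fintype R] [DecidableEq R] [Fintype C]
    (K : Matrix C C ℂ) (ρ : Matrix (R × C) (R × C) ℂ) (r r' : R) :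
    ∑ c, conjBy ((1 : Matrix R R ℂ) ⊗ₖ K) ρ (r, c) (r', c) = condOp (Kᴴ * K) ρ r r' := by
  have h : ∀ c, conjBy ((1 : Matrix R R ℂ) ⊗ₖ K) ρ (r, c) (r', c) =
      (K * (Matrix.of fun c c' => ρ (r, c) (r', c')) * Kᴴ) c c := fun c => by
    rw [conjBy, Matrix.mul_apply, Fintype.sum_prod_type, Finset.sum_eq_single r']
    · simp only [one_kronecker_mul_apply]
      simp [Matrix.mul_apply]
    · intro s _ hs
      simp [hs.symm]
    · simp
  rw [condOp_apply, Finset.sum_congr rfl fun c _ => h c, Matrix.mul_assoc Kᴴ,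
    ← Matrix.trace_mul_comm]
  rfl

theorem idTensor_eq_sum_condOp {C D R : Type} [Fintype C] [DecidableEq C] [Fintype D]
    [Fintype R] [DecidableEq R] {k : ℕ} {Φ : Matrix C C ℂ →ₗ[ℂ] Matrix D D ℂ}
    {M : Fin k → Matrix C C ℂ} {γ : Fin k → D → ℂ} (h : IsMeasurePrepare Φ M γ)
    (ρ : Matrix (R × C) (R × C) ℂ) :
    idTensor R Φ ρ = ∑ n, condOp (M n) ρ ⊗ₖ pureState (γ n) := by
  ext x y
  simp [idTensor, h.2.2, Matrix.sum_apply, condOp_apply]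

theorem traceC_measurePrepareProcedure {A B C D : Type} [Fintype A] [DecidableEq A] [Fintype B]
    [DecidableEq B] [Fintype C] [Fintype D] [DecidableEq D] {k : ℕ}
    (K : Fin k → Matrix C C ℂ) (γ : Fin k → D → ℂ)
    (ρ : Matrix ((A × B) × C) ((A × B) × C) ℂ) {δ : Matrix D D ℂ} (hδ : δ.trace = 1) :
    traceC (measurePrepareProcedure K γ (withAncilla ρ δ)) =
      cutABD (∑ n, condOp ((K n)ᴴ * K n) ρ ⊗ₖ pureState (γ n)) := by
  have h : measurePrepareProcedure K γ (withAncilla ρ δ) = ∑ n, withAncilla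
      (conjBy ((1 : Matrix (A × B) (A × B) ℂ) ⊗ₖ K n) ρ) (pureState (γ n)) := by
    refine Finset.sum_congr rfl fun n _ => ?_
    simp_rw [conjBy_withAncilla, conjBy_reset]
    ext x y
    -- Resetting from `|d⟩` contributes the weight `δ d d`; the weights add up to `tr δ = 1`, so the
    -- initial ancilla state drops out.
    rw [Matrix.sum_apply, ← one_mul (withAncilla _ _ x y), ← hδ, Matrix.trace, Finset.sum_mul]
    refine Finset.sum_congr rfl fun d _ => ?_
    simp only [withAncilla, submatrix_apply, kroneckerMap_apply, Matrix.smul_apply, smul_eq_mul, diag_apply]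
    ring
  ext ⟨a, b, d⟩ ⟨a', b', d'⟩
  rw [h]
  simp only [traceC, cutABD, of_apply, submatrix_apply, Matrix.sum_apply, kroneckerMap_apply,
    withAncilla]
  rw [Finset.sum_comm]
  refine Finset.sum_congr rfl fun n _ => ?_
  rw [← Finset.sum_mul, sum_conjBy_apply]

/-! ### The measure-and-prepare form of an entanglement-breaking channel -/

theorem pureState_trace {D : Type} [Fintype D] {v : D → ℂ} (hv : star v ⬝ᵥ v = 1) :
    (pureState v).trace = 1 := by
  rw [pureState, Matrix.trace_vecMulVec, dotProduct_comm, hv]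

/-- Spectral decomposition of a positive semidefinite matrix into pure states. -/
theorem exists_sum_smul_pureState {D : Type} [Fintype D] [DecidableEq D] {τ : Matrix D D ℂ}
    (hτ : τ.PosSemidef) : ∃ (w : D → ℝ) (γ : D → D → ℂ), (∀ d, 0 ≤ w d) ∧
      (∀ d, star (γ d) ⬝ᵥ γ d = 1) ∧ τ = ∑ d, (w d : ℂ) • pureState (γ d) := by
  have hU := hτ.1.eigenvectorUnitary.2
  set U : Matrix D D ℂ := (hτ.1.eigenvectorUnitary).1
  refine ⟨hτ.1.eigenvalues, fun d i => U i d, hτ.eigenvalues_nonneg, fun d => ?_, ?_⟩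
  · have := congrFun (congrFun (Matrix.mem_unitaryGroup_iff'.1 hU) d) d
    simpa [Matrix.mul_apply, dotProduct, star_eq_conjTranspose] using this
  · have hs : τ = U * diagonal (fun d => (hτ.1.eigenvalues d : ℂ)) * Uᴴ := by
      have := hτ.1.spectral_theorem
      rw [Unitary.conjStarAlgAut_apply] at this
      exact this
    ext i j
    conv_lhs => rw [hs]
    rw [Matrix.mul_apply]
    simp only [mul_diagonal, Matrix.sum_apply, Matrix.smul_apply, pureState, vecMulVec_apply,
      conjTranspose_apply, Pi.star_apply, smul_eq_mul]
    exact Finset.sum_congr rfl fun d _ => by ring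

/-- The maximally entangled state of two copies of `C`. -/
noncomputable def maxEntangled (C : Type) [Fintype C] [DecidableEq C] :
    Matrix (C × C) (C × C) ℂ :=
  ((Fintype.card C : ℝ)⁻¹ : ℂ) • pureState fun x : C × C => if x.1 = x.2 then 1 else 0

theorem maxEntangled_isDensityMatrix {C : Type} [Fintype C] [DecidableEq C] [Nonempty C] :
    IsDensityMatrix (maxEntangled C) := by
  constructor
  · refine (Matrix.posSemidef_vecMulVec_self_star _).smul ?_
    rw [← Complex.ofReal_inv, Complex.zero_le_real]
    positivity
  · have h : (Fintype.card C : ℂ) ≠ 0 := by simp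
    simp [maxEntangled, pureState, Matrix.trace_vecMulVec, dotProduct, Fintype.sum_prod_type, h]

/-- Choi's correspondence: the `(i, j)` block of the maximally entangled state is the matrix unit
divided by the dimension of `C`, so linearity recovers `Φ`. -/
theorem idTensor_maxEntangled {C D : Type} [Fintype C] [DecidableEq C] [Nonempty C]
    (Φ : Matrix C C ℂ →ₗ[ℂ] Matrix D D ℂ) (i j : C) (d d' : D) :
    Φ (Matrix.single i j 1) d d' =
      Fintype.card C * idTensor C Φ (maxEntangled C) (i, d) (j, d') := by
  have h : (Fintype.card C : ℂ) ≠ 0 := by simp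
  have hb : (Matrix.of fun c c' => maxEntangled C (i, c) (j, c')) =
      (Fintype.card C : ℂ)⁻¹ • Matrix.single i j (1 : ℂ) := by
    ext c c'
    simp [maxEntangled, pureState, vecMulVec_apply, Matrix.single_apply, ite_and]
    split_ifs <;> rfl
  simp only [idTensor, of_apply]
  rw [hb, map_smul, Matrix.smul_apply, smul_eq_mul, mul_inv_cancel_left₀ h]

theorem map_apply_eq_sum {C D : Type} [Fintype C] [DecidableEq C]
    (Φ : Matrix C C ℂ →ₗ[ℂ] Matrix D D ℂ) (X : Matrix C C ℂ) (d d' : D) :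
    Φ X d d' = ∑ i, ∑ j, X i j * Φ (Matrix.single i j 1) d d' := by
  conv_lhs => rw [Matrix.matrix_eq_sum_single X]
  simp only [map_sum, Matrix.sum_apply]
  refine Finset.sum_congr rfl fun i _ => Finset.sum_congr rfl fun j _ => ?_
  rw [← smul_eq_mul, ← Matrix.smul_apply, ← map_smul, Matrix.smul_single, smul_eq_mul, mul_one]

theorem eq_one_of_trace_mul {C : Type} [Fintype C] [DecidableEq C] {M : Matrix C C ℂ}
    (h : ∀ X : Matrix C C ℂ, (M * X).trace = X.trace) : M = 1 :=
  Matrix.ext_iff_trace_mul_right.2 fun X => by rw [h, one_mul]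

theorem IsEntanglementBreaking.exists_isMeasurePrepare {C D : Type} [Fintype C] [DecidableEq C]
    [Fintype D] [DecidableEq D] {Φ : Matrix C C ℂ →ₗ[ℂ] Matrix D D ℂ}
    (hΦ : IsEntanglementBreaking Φ) :
    ∃ (k : ℕ) (M : Fin k → Matrix C C ℂ) (γ : Fin k → D → ℂ), IsMeasurePrepare Φ M γ := by
  rcases isEmpty_or_nonempty C with hC | hC
  -- In dimension zero there is no maximally entangled state, but the empty POVM works because `0 =
  -- 1` there.
  · refine ⟨0, fun _ => 0, fun _ => 0, ⟨fun n => n.elim0, Subsingleton.elim _ _⟩,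
      fun n => n.elim0, fun X => ?_⟩
    rw [Subsingleton.elim X 0, map_zero]
    simp
  obtain ⟨m, p, σ, τ, hp, -, hσ, hτ, hsep⟩ := hΦ.2 C _ maxEntangled_isDensityMatrix
  choose w g hw hg hdec using fun k => exists_sum_smul_pureState (hτ k).1
  let e := (Fintype.equivFin (Fin m × D)).symm
  -- The transpose arises from `∑ X i j * σ i j = tr (σᵀ X)`; the factor `card C` undoes the
  -- normalisation of the maximally entangled state.
  let N : Fin m × D → Matrix C C ℂ := fun x =>
    ((Fintype.card C * p x.1 * w x.1 x.2 : ℝ) : ℂ) • (σ x.1)ᵀ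
  have hform : ∀ X, Φ X = ∑ x : Fin m × D, (N x * X).trace • pureState (g x.1 x.2) := by
    intro X
    ext d d'
    rw [map_apply_eq_sum]
    simp_rw [idTensor_maxEntangled, hsep, Fintype.sum_prod_type]
    have ht : ∀ k, (τ k) d d' = ∑ y, (w k y : ℂ) * pureState (g k y) d d' := fun k => by
      conv_lhs => rw [hdec k]
      simp [Matrix.sum_apply]
    have hN : ∀ x, (N x * X).trace = (Fintype.card C * p x.1 * w x.1 x.2 : ℂ) *
        ∑ i, ∑ j, X i j * σ x.1 i j := fun x => by
      simp only [N, smul_mul_assoc, trace_smul, smul_eq_mul]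
      rw [Finset.sum_comm]
      simp [Matrix.trace, Matrix.mul_apply, mul_comm]
    simp only [Matrix.sum_apply, Matrix.smul_apply, kroneckerMap_apply, smul_eq_mul, hN, ht]
    simp only [Finset.mul_sum, Finset.sum_mul]
    rw [Finset.sum_congr rfl fun i _ => Finset.sum_comm, Finset.sum_comm]
    refine Finset.sum_congr rfl fun k _ => ?_
    rw [Finset.sum_congr rfl fun i _ => Finset.sum_comm, Finset.sum_comm]
    exact Finset.sum_congr rfl fun y _ => Finset.sum_congr rfl fun i _ =>
      Finset.sum_congr rfl fun j _ => by ring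
  -- Completeness comes from trace preservation: `tr X = tr (Φ X) = tr ((∑ N x) X)` for all `X`, and
  -- the trace pairing is nondegenerate.
  have hsum : ∑ x, N x = 1 := by
    refine eq_one_of_trace_mul fun X => ?_
    rw [← hΦ.1.2 X, hform X, Matrix.trace_sum, Finset.sum_mul, Matrix.trace_sum]
    exact Finset.sum_congr rfl fun x _ => by
      rw [trace_smul, pureState_trace (hg x.1 x.2), smul_eq_mul, mul_one]
  refine ⟨_, fun n => N (e n), fun n => g (e n).1 (e n).2, ⟨fun n => ?_, ?_⟩,
    fun n => hg _ _, fun X => ?_⟩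
  · refine (hσ _).1.transpose.smul (Complex.zero_le_real.2 ?_)
    have := hp (e n).1
    have := hw (e n).1 (e n).2
    positivity
  · rw [← hsum]
    exact Equiv.sum_comp e N
  · rw [hform X]
    exact (Equiv.sum_comp e fun x => (N x * X).trace • pureState (g x.1 x.2)).symm

theorem IsChannel.nonempty {C D : Type} [Fintype C] [DecidableEq C] [Fintype D] [Nonempty C]
    {Φ : Matrix C C ℂ →ₗ[ℂ] Matrix D D ℂ} (hΦ : IsChannel Φ) : Nonempty D := by
  by_contra hD
  rw [not_nonempty_iff] at hD
  have h := hΦ.2 1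
  have hc : (Fintype.card C : ℂ) ≠ 0 := by simp
  simp [Matrix.trace, hc.symm] at h

theorem single_isDensityMatrix {D : Type} [Fintype D] [DecidableEq D] (d : D) :
    IsDensityMatrix (pureState (Pi.single d (1 : ℂ))) :=
  ⟨Matrix.posSemidef_vecMulVec_self_star _, pureState_trace (by simp)⟩

theorem IsDensityMatrix.nonempty {X : Type} [Fintype X] {ρ : Matrix X X ℂ}
    (hρ : IsDensityMatrix ρ) : Nonempty X := by
  by_contra hX
  rw [not_nonempty_iff] at hX
  simpa [Matrix.trace] using hρ.2

/-! ### No entanglement gain -/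

theorem traceC_measurePrepareProcedure_eq {A B C D : Type} [Fintype A] [DecidableEq A]
    [Fintype B] [DecidableEq B] [Fintype C] [DecidableEq C] [Fintype D] [DecidableEq D] {k : ℕ}
    {Φ : Matrix C C ℂ →ₗ[ℂ] Matrix D D ℂ} {M : Fin k → Matrix C C ℂ} {γ : Fin k → D → ℂ}
    (h : IsMeasurePrepare Φ M γ) {K : Fin k → Matrix C C ℂ} (hK : ∀ n, (K n)ᴴ * K n = M n)
    (ρ : Matrix ((A × B) × C) ((A × B) × C) ℂ) {δ : Matrix D D ℂ} (hδ : δ.trace = 1) :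
    traceC (measurePrepareProcedure K γ (withAncilla ρ δ)) =
      cutABD (idTensor (A × B) Φ ρ) := by
  rw [traceC_measurePrepareProcedure K γ ρ hδ, idTensor_eq_sum_condOp h ρ]
  simp_rw [hK]

theorem measurePrepare_gain_le {A B C D : Type} [Fintype A] [DecidableEq A]
    [Fintype B] [DecidableEq B] [Fintype C] [DecidableEq C] [Fintype D] [DecidableEq D] {k : ℕ}
    {Φ : Matrix C C ℂ →ₗ[ℂ] Matrix D D ℂ} {M : Fin k → Matrix C C ℂ} {γ : Fin k → D → ℂ}
    (h : IsMeasurePrepare Φ M γ) {K : Fin k → Matrix C C ℂ} (hK : ∀ n, (K n)ᴴ * K n = M n)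
    {ρ : Matrix ((A × B) × C) ((A × B) × C) ℂ} (hρ : IsDensityMatrix ρ) {δ : Matrix D D ℂ}
    (hδ : IsDensityMatrix δ) {E : ∀ X Y : Type, Matrix (X × Y) (X × Y) ℂ → ℝ}
    (hE : IsEntanglementMonotone E) :
    E A (B × D) (cutABD (idTensor (A × B) Φ ρ)) - E (A × C) B (cutACB ρ) ≤
        E (A × C) (B × D) (measurePrepareProcedure K γ (withAncilla ρ δ)) -
          E (A × C) (B × D) (withAncilla ρ δ) ∧
      E (A × C) (B × D) (measurePrepareProcedure K γ (withAncilla ρ δ)) -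
        E (A × C) (B × D) (withAncilla ρ δ) ≤ 0 := by
  have hLOCC := measurePrepareProcedure_isLOCC (A := A) (B := B)
    (show ∑ n, (K n)ᴴ * K n = 1 by simp_rw [hK, h.1.2]) h.2.1
  obtain ⟨Λ, hΛ, hΛeq⟩ := exists_isLOCC_withAncilla (A := A) (B := B) (C := C) hδ
  have hcut := cutACB_isDensityMatrix hρ
  have hanc : IsDensityMatrix (withAncilla ρ δ) := hΛeq ρ ▸ hΛ.isDensityMatrix hcut
  have h₁ := hE _ _ _ _ _ traceC_isLOCC _ (hLOCC.isDensityMatrix hanc)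
  have h₂ := hE _ _ _ _ _ hLOCC _ hanc
  have h₃ := hE _ _ _ _ _ hΛ _ hcut
  rw [traceC_measurePrepareProcedure_eq h hK ρ hδ.2] at h₁
  rw [hΛeq] at h₃
  constructor <;> linarith

end EntDist

theorem mainTheorem4 {C D : Type} [Fintype C] [DecidableEq C] [Fintype D] [DecidableEq D]
    (Φ : Matrix C C ℂ →ₗ[ℂ] Matrix D D ℂ) (hΦ : EntDist.IsEntanglementBreaking Φ) :
    -- `Φ` is a measure-and-prepare channel
    (∃ (k : ℕ) (M : Fin k → Matrix C C ℂ) (γ : Fin k → D → ℂ),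
      EntDist.IsMeasurePrepare Φ M γ) ∧
    -- for every such form of `Φ`, every implementation of its POVM, and all laboratories `A`, `B`
    (∀ (k : ℕ) (M : Fin k → Matrix C C ℂ) (γ : Fin k → D → ℂ),
      EntDist.IsMeasurePrepare Φ M γ →
      ∀ K : Fin k → Matrix C C ℂ, (∀ n, (K n)ᴴ * K n = M n) →
      ∀ (A B : Type) [Fintype A] [DecidableEq A] [Fintype B] [DecidableEq B],
      -- the procedure is LOCC between `AC` and `BD`
      EntDist.IsLOCC
        (EntDist.measurePrepareProcedure (A := A) (B := B) K γ) ∧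
      ∀ ρ : Matrix ((A × B) × C) ((A × B) × C) ℂ, EntDist.IsDensityMatrix ρ →
        -- the output of the channel is `∑ p n ρ_{AB|n} ⊗ γ n`
        EntDist.idTensor (A × B) Φ ρ =
          ∑ n, EntDist.condOp (M n) ρ ⊗ₖ EntDist.pureState (γ n) ∧
        ∀ δ : Matrix D D ℂ, EntDist.IsDensityMatrix δ →
          -- the procedure produces the output of the channel on `A`, `B`, `D`
          EntDist.traceC (EntDist.measurePrepareProcedure K γ (EntDist.withAncilla ρ δ)) =
            EntDist.cutABD (EntDist.idTensor (A × B) Φ ρ) ∧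
          -- the two inequalities
          ∀ E : ∀ X Y : Type, Matrix (X × Y) (X × Y) ℂ → ℝ, EntDist.IsEntanglementMonotone E →
            E A (B × D) (EntDist.cutABD (EntDist.idTensor (A × B) Φ ρ))
                - E (A × C) B (EntDist.cutACB ρ)
              ≤ E (A × C) (B × D)
                  (EntDist.measurePrepareProcedure K γ (EntDist.withAncilla ρ δ))
                - E (A × C) (B × D) (EntDist.withAncilla ρ δ) ∧
            E (A × C) (B × D)
                  (EntDist.measurePrepareProcedure K γ (EntDist.withAncilla ρ δ))
                - E (A × C) (B × D) (EntDist.withAncilla ρ δ) ≤ 0) ∧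
    -- no entanglement gain
    (∀ (A B : Type) [Fintype A] [DecidableEq A] [Fintype B] [DecidableEq B]
      (ρ : Matrix ((A × B) × C) ((A × B) × C) ℂ), EntDist.IsDensityMatrix ρ →
      ∀ E : ∀ X Y : Type, Matrix (X × Y) (X × Y) ℂ → ℝ, EntDist.IsEntanglementMonotone E →
        E A (B × D) (EntDist.cutABD (EntDist.idTensor (A × B) Φ ρ))
          ≤ E (A × C) B (EntDist.cutACB ρ)) := by
  refine ⟨hΦ.exists_isMeasurePrepare, ?_, ?_⟩
  · intro k M γ h K hK A B _ _ _ _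
    have hLOCC := EntDist.measurePrepareProcedure_isLOCC (A := A) (B := B)
      (show ∑ n, (K n)ᴴ * K n = 1 by simp_rw [hK, h.1.2]) h.2.1
    refine ⟨hLOCC, fun ρ hρ => ⟨EntDist.idTensor_eq_sum_condOp h ρ, fun δ hδ => ?_⟩⟩
    exact ⟨EntDist.traceC_measurePrepareProcedure_eq h hK ρ hδ.2,
      fun E hE => EntDist.measurePrepare_gain_le h hK hρ hδ hE⟩
  · intro A B _ _ _ _ ρ hρ E hE
    obtain ⟨k, M, γ, h⟩ := hΦ.exists_isMeasurePrepare
    choose K hK using fun n => EntDist.exists_conjTranspose_mul_self_eq (h.1.1 n)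
    -- The gain bound needs some ancilla state, hence a nonempty `D`. A state on `ABC` forces `C` to
    -- be nonempty, and trace preservation passes this on to `D`; any basis state then serves.
    have : Nonempty C := hρ.nonempty.map Prod.snd
    obtain ⟨d⟩ := hΦ.1.nonempty
    have hgain := EntDist.measurePrepare_gain_le h hK hρ
      (EntDist.single_isDensityMatrix d) hE
    linarith [hgain.1, hgain.2]
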